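/- All spaces are real. Let $X$ and $Y$ be Banach spaces, let $X\widehat{\otimes}_\pi Y$ be their projective tensor product (the completion of $X\otimes Y$ for the norm $\pi(z)=\inf\{\sum_i\|x_i\|\|y_i\| : z=\sum_i x_i\otimes y_i\}$), and let $L(X,Y^*)$ and $K(X,Y^*)$ be the spaces of bounded and of compact linear operators from $X$ to $Y^*$. Every $T\in L(X,Y^*)$ acts on $X\widehat{\otimes}_\pi Y$ as the continuous linear functional with $T(x\otimes y)=T(x)(y)$. A point $x$ of a subset $A$ of a Banach space $E$ is called *$w$-strongly exposed* in $A$ if there is $f\in E^*$ such that $f(x)>f(a)$ for all $a\in A\setminus\{x\}$ and such that every sequence $(a_n)$ in $A$ with $f(a_n)\to f(x)$ converges weakly to $x$; the set of these points is $w\text{-}\mathrm{strexp}(A)$. For bounded $A$, $f\in E^*$ and $\alpha>0$, let $S(A,f,\alpha)=\{a\in A: f(a)>\sup f(A)-\alpha\}$. For $C\subseteq X$, $D\subseteq Y$ put $C\otimes D=\{x\otimes y: x\in C,\ y\in D\}$ and let $\overline{\mathrm{conv}}(C\otimes D)$ be its closed convex hull in $X\widehat{\otimes}_\pi Y$. A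 point $x\otimes y$ with $x\in C$, $y\in D$ *has a compact neighbourhood system for the weak topology in $\overline{\mathrm{conv}}(C\otimes D)$* if for every weakly open $U\subseteq X\widehat{\otimes}_\pi Y$ containing $x\otimes y$ there are finitely many $T_1,\dots,T_n\in K(X,Y^*)$ and $\alpha_1,\dots,\alpha_n>0$ with $x\otimes y\in\bigcap_{i=1}^n S(\overline{\mathrm{conv}}(C\otimes D),T_i,\alpha_i)\subseteq U$. **Theorem.** Assume that $K(X,Y^*)$ separates the points of $X\widehat{\otimes}_\pi Y$. (This holds in particular if the pair $(X,Y^*)$ has the compact approximation property, that is, if $K(X,Y^*)$ is dense in $L(X,Y^*)$ for the topology of uniform convergence on compact subsets of $X$.) Let $C\subseteq X$ and $D\subseteq Y$ be symmetric ($C=-C$, $D=-D$), bounded, closed, convex sets with $C\neq\{0\}$ and $D\neq\{0\}$. 1. Let $x\in C$ and $y\in D$ be such that $x\otimes y$ has a compact neighbourhood system for the weak topology in $\overline{\mathrm{conv}}(C\otimes D)$. Then $x\otimes y$ is $w$-strongly exposed in $\overline{\mathrm{conv}}(C\otimes D)$ if and only if $x$ is $w$-strongly exposed in $C$ and $y$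 is $w$-strongly exposed in $D$. 2. In particular, if $C\otimes D$ is weakly compact, then $$w\text{-}\mathrm{strexp}(\overline{\mathrm{conv}}(C\otimes D))=w\text{-}\mathrm{strexp}(C)\otimes w\text{-}\mathrm{strexp}(D).$$ -/

import Mathlib

open Set Filter Topology
open scoped TensorProduct

noncomputable section

/-- The algebraic tensor product of two real normed spaces, as a type of its own that carries the
projective norm. -/
def AlgProjTensor (X Y : Type*) [NormedAddCommGroup X] [NormedSpace ℝ X]
    [NormedAddCommGroup Y] [NormedSpace ℝ Y] : Type _ :=
  X ⊗[ℝ] Y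

namespace AlgProjTensor

variable {X Y : Type*} [NormedAddCommGroup X] [NormedSpace ℝ X]
  [NormedAddCommGroup Y] [NormedSpace ℝ Y]

instance instAddCommGroup : AddCommGroup (AlgProjTensor X Y) :=
  inferInstanceAs (AddCommGroup (X ⊗[ℝ] Y))

instance instModule : Module ℝ (AlgProjTensor X Y) :=
  inferInstanceAs (Module ℝ (X ⊗[ℝ] Y))

/-- The elementary tensor `x ⊗ y` in the algebraic tensor product. -/
def tmul (x : X) (y : Y) : AlgProjTensor X Y := x ⊗ₜ[ℝ] y

/-- The element `∑ xᵢ ⊗ yᵢ` represented by a finite list of pairs `(xᵢ, yᵢ)`. -/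
def listSum (l : List (X × Y)) : AlgProjTensor X Y :=
  (l.map fun p => tmul p.1 p.2).sum

/-- The cost `∑ ‖xᵢ‖ ‖yᵢ‖` of a finite list of pairs `(xᵢ, yᵢ)`. -/
def listCost (l : List (X × Y)) : ℝ :=
  (l.map fun p => ‖p.1‖ * ‖p.2‖).sum

/-- The projective norm `π(z) = inf {∑ ‖xᵢ‖ ‖yᵢ‖ : z = ∑ xᵢ ⊗ yᵢ}`. -/
def projNorm (z : AlgProjTensor X Y) : ℝ :=
  sInf (listCost '' {l : List (X × Y) | listSum l = z})

theorem listCost_nonneg (l : List (X × Y)) : 0 ≤ listCost l := by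
  refine List.sum_nonneg fun a ha => ?_
  obtain ⟨p, -, rfl⟩ := List.mem_map.1 ha
  positivity

theorem exists_listSum (z : AlgProjTensor X Y) : ∃ l : List (X × Y), listSum l = z := by
  have key : ∀ w : X ⊗[ℝ] Y, ∃ l : List (X × Y), listSum l = (w : AlgProjTensor X Y) := by
    intro w
    induction w with
    | zero => exact ⟨[], rfl⟩
    | tmul x y => exact ⟨[(x, y)], add_zero _⟩
    | add a b ha hb =>
      obtain ⟨la, hla⟩ := ha
      obtain ⟨lb, hlb⟩ := hb
      refine ⟨la ++ lb, ?_⟩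
      rw [listSum, List.map_append, List.sum_append]
      exact congrArg₂ (fun s t : AlgProjTensor X Y => s + t) hla hlb
  exact key z

theorem projNorm_le {z : AlgProjTensor X Y} {l : List (X × Y)} (h : listSum l = z) :
    projNorm z ≤ listCost l :=
  csInf_le ⟨0, by rintro _ ⟨l, -, rfl⟩; exact listCost_nonneg l⟩ ⟨l, h, rfl⟩

theorem le_projNorm {z : AlgProjTensor X Y} {r : ℝ}
    (h : ∀ l : List (X × Y), listSum l = z → r ≤ listCost l) : r ≤ projNorm z := by
  obtain ⟨l, hl⟩ := exists_listSum z
  refine le_csInf ⟨_, l, hl, rfl⟩ ?_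
  rintro _ ⟨l, hl, rfl⟩
  exact h l hl

theorem projNorm_zero : projNorm (0 : AlgProjTensor X Y) = 0 :=
  le_antisymm (projNorm_le (l := []) rfl) (le_projNorm fun l _ => listCost_nonneg l)

theorem projNorm_add_le (z w : AlgProjTensor X Y) :
    projNorm (z + w) ≤ projNorm z + projNorm w := by
  have h1 : ∀ l : List (X × Y), listSum l = z → projNorm (z + w) - listCost l ≤ projNorm w := by
    intro l hl
    refine le_projNorm fun m hm => ?_
    have := projNorm_le (z := z + w) (l := l ++ m) (by
      rw [listSum, List.map_append, List.sum_append, ← hl, ← hm]; rfl)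
    have h2 : listCost (l ++ m) = listCost l + listCost m := by
      rw [listCost, List.map_append, List.sum_append]; rfl
    linarith
  have := le_projNorm (z := z) (r := projNorm (z + w) - projNorm w)
    fun l hl => by linarith [h1 l hl]
  linarith

theorem projNorm_smul_le (a : ℝ) (z : AlgProjTensor X Y) :
    projNorm (a • z) ≤ ‖a‖ * projNorm z := by
  have key : ∀ l : List (X × Y), listSum l = z → projNorm (a • z) ≤ ‖a‖ * listCost l := by
    intro l hl
    have h1 : listSum (l.map fun p => (a • p.1, p.2)) = a • z := by
      rw [← hl, listSum, listSum, List.smul_sum, List.map_map, List.map_map]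
      rfl
    have h2 : listCost (l.map fun p => (a • p.1, p.2)) = ‖a‖ * listCost l := by
      rw [listCost, listCost, List.map_map, ← List.sum_map_mul_left]
      congr 1
      refine List.map_congr_left fun p _ => ?_
      simp only [Function.comp_apply, norm_smul]
      ring
    exact (projNorm_le h1).trans h2.le
  rcases eq_or_ne a 0 with rfl | ha
  · rw [zero_smul, projNorm_zero, norm_zero, zero_mul]
  · have hpos : 0 < ‖a‖ := norm_pos_iff.2 ha
    have := le_projNorm (z := z) (r := projNorm (a • z) / ‖a‖)
      fun l hl => (div_le_iff₀' hpos).2 (key l hl)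
    exact (div_le_iff₀' hpos).1 this

instance instSeminormedAddCommGroup : SeminormedAddCommGroup (AlgProjTensor X Y) :=
  (Seminorm.ofSMulLE (𝕜 := ℝ) projNorm projNorm_zero projNorm_add_le
    projNorm_smul_le).toAddGroupSeminorm.toSeminormedAddCommGroup

theorem norm_def (z : AlgProjTensor X Y) : ‖z‖ = projNorm z := rfl

instance instNormedSpace : NormedSpace ℝ (AlgProjTensor X Y) := ⟨projNorm_smul_le⟩

/-- The linear functional `∑ xᵢ ⊗ yᵢ ↦ ∑ T(xᵢ)(yᵢ)` of an operator `T : X → Y*`. -/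
def evalLinear (T : X →L[ℝ] StrongDual ℝ Y) : AlgProjTensor X Y →ₗ[ℝ] ℝ :=
  TensorProduct.lift ((ContinuousLinearMap.coeLM ℝ).comp T.toLinearMap : X →ₗ[ℝ] Y →ₗ[ℝ] ℝ)

theorem evalLinear_tmul (T : X →L[ℝ] StrongDual ℝ Y) (x : X) (y : Y) :
    evalLinear T (tmul x y) = T x y :=
  TensorProduct.lift.tmul x y

theorem norm_evalLinear_le (T : X →L[ℝ] StrongDual ℝ Y) (z : AlgProjTensor X Y) :
    ‖evalLinear T z‖ ≤ ‖T‖ * ‖z‖ := by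
  have key : ∀ l : List (X × Y), ‖evalLinear T (listSum l)‖ ≤ ‖T‖ * listCost l := by
    intro l
    induction l with
    | nil => simp [listSum, listCost]
    | cons p l ih =>
      have h1 : listSum (p :: l) = tmul p.1 p.2 + listSum l := by simp [listSum]
      have h2 : listCost (p :: l) = ‖p.1‖ * ‖p.2‖ + listCost l := by simp [listCost]
      rw [h1, h2, map_add, evalLinear_tmul]
      calc ‖T p.1 p.2 + evalLinear T (listSum l)‖
          ≤ ‖T p.1 p.2‖ + ‖evalLinear T (listSum l)‖ := norm_add_le _ _
        _ ≤ ‖T‖ * ‖p.1‖ * ‖p.2‖ + ‖T‖ * listCost l := add_le_add (T.le_opNorm₂ _ _) ih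
        _ = ‖T‖ * (‖p.1‖ * ‖p.2‖ + listCost l) := by ring
  rcases (norm_nonneg T).eq_or_lt with h0 | hpos
  · obtain ⟨l, hl⟩ := exists_listSum z
    have := key l
    rw [hl, ← h0, zero_mul] at this
    rwa [← h0, zero_mul]
  · refine (div_le_iff₀' hpos).1 (le_projNorm fun l hl => (div_le_iff₀' hpos).2 ?_)
    rw [← hl]
    exact key l

/-- The functional of `T : X → Y*` as a continuous linear functional for the projective norm. -/
def evalCLM (T : X →L[ℝ] StrongDual ℝ Y) : StrongDual ℝ (AlgProjTensor X Y) :=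
  (evalLinear T).mkContinuous ‖T‖ (norm_evalLinear_le T)

end AlgProjTensor

/-- The projective tensor product `X ⊗̂_π Y`: the completion of the algebraic tensor product
for the projective norm. It is a real Banach space. -/
abbrev ProjTensor (X Y : Type*) [NormedAddCommGroup X] [NormedSpace ℝ X]
    [NormedAddCommGroup Y] [NormedSpace ℝ Y] : Type _ :=
  UniformSpace.Completion (AlgProjTensor X Y)

namespace ProjTensor

variable {X Y : Type*} [NormedAddCommGroup X] [NormedSpace ℝ X]
  [NormedAddCommGroup Y] [NormedSpace ℝ Y]

/-- The elementary tensor `x ⊗ y` in `X ⊗̂_π Y`. -/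
def tmul (x : X) (y : Y) : ProjTensor X Y :=
  ((AlgProjTensor.tmul x y : AlgProjTensor X Y) : UniformSpace.Completion (AlgProjTensor X Y))

/-- The set `C ⊗ D = {x ⊗ y : x ∈ C, y ∈ D}` of elementary tensors. -/
def setTensor (C : Set X) (D : Set Y) : Set (ProjTensor X Y) :=
  image2 tmul C D

/-- The functional on `X ⊗̂_π Y` given by an operator `T : X → Y*`: the continuous linear
extension of `x ⊗ y ↦ T(x)(y)`. -/
def functional (T : X →L[ℝ] StrongDual ℝ Y) : StrongDual ℝ (ProjTensor X Y) :=
  (AlgProjTensor.evalCLM T).extend UniformSpace.Completion.toComplL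

theorem functional_tmul (T : X →L[ℝ] StrongDual ℝ Y) (x : X) (y : Y) :
    functional T (tmul x y) = T x y := by
  have h := (AlgProjTensor.evalCLM T).extend_eq
    (e := (UniformSpace.Completion.toComplL : AlgProjTensor X Y →L[ℝ] _))
    UniformSpace.Completion.denseRange_coe
    (UniformSpace.Completion.isUniformInducing_coe (AlgProjTensor X Y))
    (AlgProjTensor.tmul x y)
  exact h.trans (AlgProjTensor.evalLinear_tmul T x y)

variable (X Y) in
/-- `K(X, Y*)` separates the points of `X ⊗̂_π Y`. -/
def CompactOperatorsSeparate : Prop :=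
  ∀ z w : ProjTensor X Y,
    (∀ T : X →L[ℝ] StrongDual ℝ Y, IsCompactOperator T → functional T z = functional T w) → z = w

end ProjTensor

/-- The pair `(X, Y)` has the compact approximation property: the compact operators are dense in
`L(X, Y)` for the topology of uniform convergence on compact sets. -/
def HasPairCAP (X Y : Type*) [NormedAddCommGroup X] [NormedSpace ℝ X]
    [NormedAddCommGroup Y] [NormedSpace ℝ Y] : Prop :=
  closure {T : CompactConvergenceCLM (RingHom.id ℝ) X Y | IsCompactOperator T} = univ

section Exposed

variable {E : Type*} [NormedAddCommGroup E] [NormedSpace ℝ E]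

/-- The open slice `S(C, f, α) = {x ∈ C : f(x) > sup f(C) - α}`, used for bounded `C`. -/
def openSlice (C : Set E) (f : StrongDual ℝ E) (α : ℝ) : Set E :=
  {x ∈ C | sSup (f '' C) - α < f x}

/-- The functional `f` exposes `x` in `C`. -/
def Exposes (C : Set E) (f : StrongDual ℝ E) (x : E) : Prop :=
  ∀ y ∈ C \ {x}, f y < f x

/-- The point `x` is `w`-strongly exposed in `C`: some functional `f` exposes `x` in `C`, and
every sequence in `C` along which `f` tends to `f x` converges weakly to `x`. -/
def IsWStronglyExposed (C : Set E) (x : E) : Prop :=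
  x ∈ C ∧ ∃ f : StrongDual ℝ E, Exposes C f x ∧
    ∀ u : ℕ → E, (∀ n, u n ∈ C) → Tendsto (fun n => f (u n)) atTop (𝓝 (f x)) →
      Tendsto (fun n => toWeakSpace ℝ E (u n)) atTop (𝓝 (toWeakSpace ℝ E x))

/-- The set of `w`-strongly exposed points of `C`. -/
def wstrexp (C : Set E) : Set E := {x | IsWStronglyExposed C x}

end Exposed

namespace ProjTensor

variable {X Y : Type*} [NormedAddCommGroup X] [NormedSpace ℝ X]
  [NormedAddCommGroup Y] [NormedSpace ℝ Y]

/-- The point `x ⊗ y` has a compact neighbourhood system for the weak topology in the closed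
convex hull of `C ⊗ D`: every weakly open set that contains `x ⊗ y` contains a finite intersection
of slices of the closed convex hull that are given by compact operators `X → Y*` and contain
`x ⊗ y`. -/
def HasCompactNhdSystem (C : Set X) (D : Set Y) (x : X) (y : Y) : Prop :=
  ∀ U : Set (WeakSpace ℝ (ProjTensor X Y)), IsOpen U → toWeakSpace ℝ _ (tmul x y) ∈ U →
    ∃ (n : ℕ) (T : Fin (n + 1) → X →L[ℝ] StrongDual ℝ Y) (α : Fin (n + 1) → ℝ),
      (∀ i, IsCompactOperator (T i)) ∧ (∀ i, 0 < α i) ∧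
      tmul x y ∈ ⋂ i, openSlice (closedConvexHull ℝ (setTensor C D)) (functional (T i)) (α i) ∧
      (⋂ i, openSlice (closedConvexHull ℝ (setTensor C D)) (functional (T i)) (α i)) ⊆
        toWeakSpace ℝ _ ⁻¹' U

end ProjTensor

end

/-! If `x ⊗ y` is `w`-strongly exposed, it is nonzero by symmetry, so `a ↦ a ⊗ y` and `b ↦ x ⊗ b`
are weak embeddings of `C` and `D` into the hull, and the property pulls back along them
(`IsWStronglyExposed.of_map`).

Conversely, let `f` and `g` expose `x` and `y`. Symmetry makes `f x` and `g y` positive, and `f ⊗ g`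
is the candidate for `x ⊗ y`. The core is `ConvergesAlong.exists_bound`: if a functional `S`
converges along all elementary tensors whose factors maximise `f` and `g`, then on the whole hull
the oscillation of `S` around `x ⊗ y` is at most `ε` plus a multiple of the deficit of `f ⊗ g`. This
inequality is convex and closed in the point, so elementary tensors suffice. Hence `S z_n → S (x ⊗
y)` along every sequence of the hull that maximises `f ⊗ g`.

Functionals of compact operators are such `S`, because compact operators turn weak into norm
convergence. They separate points, which gives exposure, and a compact neighbourhood system upgrades
their convergence to weak convergence. If `C ⊗ D` is weakly compact, separation alone identifies the
weak cluster points, so every functional is such an `S`; a `w`-strongly exposed point of the hull is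
moreover a weak limit of elementary tensors, hence one itself. -/

theorem MapClusterPt.eq_of_tendsto {α ι : Type*} [TopologicalSpace α] [T2Space α] {l : Filter ι}
    {u : ι → α} {a b : α} (hb : MapClusterPt b l u) (ha : Tendsto u l (𝓝 a)) : b = a :=
  eq_of_nhds_neBot (ClusterPt.mono hb ha)

/-- A set made of `0` and of finite sets `s n` that shrink to `0` is compact. -/
theorem isCompact_insert_zero_iUnion_of_finite {E : Type*} [SeminormedAddCommGroup E]
    {s : ℕ → Set E} (hs : ∀ n, (s n).Finite) {r : ℕ → ℝ}
    (hr : Tendsto r atTop (𝓝 0)) (hsr : ∀ n, ∀ a ∈ s n, ‖a‖ ≤ r n) :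
    IsCompact (insert 0 (⋃ n, s n)) := by
  refine isCompact_of_finite_subcover fun {ι} U hU hcov => ?_
  -- The member of the cover that contains `0` swallows all but finitely many of the sets `s n`.
  obtain ⟨i, hi⟩ := mem_iUnion.1 (hcov (mem_insert _ _))
  obtain ⟨δ, hδ, hball⟩ := Metric.isOpen_iff.1 (hU i) 0 hi
  obtain ⟨N, hN⟩ := eventually_atTop.1 (hr.eventually (gt_mem_nhds hδ))
  have hfin : (⋃ n ∈ Finset.range N, s n).Finite :=
    (Finset.range N).finite_toSet.biUnion fun n _ => hs n
  obtain ⟨t, ht⟩ := hfin.isCompact.elim_finite_subcover U hU fun a ha => by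
    obtain ⟨n, -, han⟩ := mem_iUnion₂.1 ha
    exact hcov (mem_insert_of_mem _ (mem_iUnion.2 ⟨n, han⟩))
  classical
  refine ⟨insert i t, fun a ha => ?_⟩
  rcases mem_insert_iff.1 ha with rfl | ha
  · exact mem_iUnion₂.2 ⟨i, Finset.mem_insert_self _ _, hi⟩
  · obtain ⟨n, hn⟩ := mem_iUnion.1 ha
    by_cases hnN : n < N
    · obtain ⟨k, hk, hak⟩ := mem_iUnion₂.1 (ht (mem_iUnion₂.2 ⟨n, Finset.mem_range.2 hnN, hn⟩))
      exact mem_iUnion₂.2 ⟨k, Finset.mem_insert_of_mem hk, hak⟩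
    · refine mem_iUnion₂.2 ⟨i, Finset.mem_insert_self _ _, hball ?_⟩
      rw [mem_ball_zero_iff]
      exact (hsr n a hn).trans_lt (hN n (not_lt.1 hnN))

/-! ### Weak convergence, exposing functionals and compact operators -/

section WeakTopology

variable {E F : Type*} [NormedAddCommGroup E] [NormedSpace ℝ E]
  [NormedAddCommGroup F] [NormedSpace ℝ F]

theorem tendsto_toWeakSpace_iff {ι : Type*} {l : Filter ι} {u : ι → E} {x : E} :
    Tendsto (fun i => toWeakSpace ℝ E (u i)) l (𝓝 (toWeakSpace ℝ E x)) ↔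
      ∀ f : StrongDual ℝ E, Tendsto (fun i => f (u i)) l (𝓝 (f x)) := by
  refine WeakBilin.tendsto_iff_forall_eval_tendsto _ fun a b hab => ?_
  by_contra hne
  obtain ⟨f, hf⟩ := SeparatingDual.exists_separating_of_ne (R := ℝ) (V := E) hne
  exact hf (DFunLike.congr_fun hab f)

theorem continuous_weakSpace_eval (f : StrongDual ℝ E) :
    Continuous fun w : WeakSpace ℝ E => f ((toWeakSpace ℝ E).symm w) :=
  WeakBilin.eval_continuous (topDualPairing ℝ E).flip f

theorem Exposes.le {A : Set E} {f : StrongDual ℝ E} {x a : E} (h : Exposes A f x) (ha : a ∈ A) :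
    f a ≤ f x := by
  rcases eq_or_ne a x with rfl | hne
  · exact le_rfl
  · exact (h a ⟨ha, hne⟩).le

/-- A nonzero `x` beats `-x`. The point `0` cannot be exposed, since `f` would be negative at both
`a` and `-a`. -/
theorem Exposes.pos_of_symmetric {A : Set E} {f : StrongDual ℝ E} {x : E} (h : Exposes A f x)
    (hx : x ∈ A) (hsymm : ∀ a ∈ A, -a ∈ A) (hA : A ≠ {0}) : 0 < f x := by
  rcases eq_or_ne x 0 with rfl | hne
  · obtain ⟨a, ha, ha0⟩ : ∃ a ∈ A, a ≠ 0 := by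
      by_contra! hall
      exact hA (Subset.antisymm hall (singleton_subset_iff.2 hx))
    have h1 := h a ⟨ha, ha0⟩
    have h2 := h (-a) ⟨hsymm a ha, neg_ne_zero.2 ha0⟩
    rw [map_neg, map_zero] at h2
    rw [map_zero] at h1
    linarith
  · have hneg : -x ≠ x := fun hneg => hne <| (smul_eq_zero_iff_right (two_ne_zero (α := ℝ))).1 <| by
      rw [two_smul, ← eq_neg_iff_add_eq_zero, hneg]
    have h1 := h (-x) ⟨hsymm x hx, hneg⟩
    rw [map_neg] at h1
    linarith

/-- `w`-strong exposedness pulls back along a weak embedding. -/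
theorem IsWStronglyExposed.of_map {A : Set E} {B : Set F} {x : E} (j : E →L[ℝ] F)
    (hj : ∀ φ : StrongDual ℝ E, ∃ ψ : StrongDual ℝ F, ∀ e, ψ (j e) = φ e)
    (hAB : MapsTo j A B) (hx : x ∈ A) (h : IsWStronglyExposed B (j x)) :
    IsWStronglyExposed A x := by
  obtain ⟨-, f, hf, hconv⟩ := h
  refine ⟨hx, f.comp j, fun a ha => hf (j a) ⟨hAB ha.1, fun hja => ha.2 ?_⟩, fun u hu hlim => ?_⟩
  · by_contra hne
    obtain ⟨φ, hφ⟩ := SeparatingDual.exists_separating_of_ne (R := ℝ) (V := E) hne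
    obtain ⟨ψ, hψ⟩ := hj φ
    exact hφ (by rw [← hψ, ← hψ, mem_singleton_iff.1 hja])
  · refine tendsto_toWeakSpace_iff.2 fun φ => ?_
    obtain ⟨ψ, hψ⟩ := hj φ
    have := tendsto_toWeakSpace_iff.1 (hconv (fun n => j (u n)) (fun n => hAB (hu n)) hlim) ψ
    simpa only [hψ] using this

/-- Compact operators map bounded weakly convergent sequences to norm convergent ones. -/
theorem IsCompactOperator.tendsto_of_weak {T : E →L[ℝ] F} (hT : IsCompactOperator T)
    {A : Set E} (hA : Bornology.IsBounded A) {u : ℕ → E} (hu : ∀ n, u n ∈ A) {x : E}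
    (hlim : ∀ f : StrongDual ℝ E, Tendsto (fun n => f (u n)) atTop (𝓝 (f x))) :
    Tendsto (fun n => T (u n)) atTop (𝓝 (T x)) := by
  obtain ⟨K, hK, hTK⟩ :=
    IsCompactOperator.image_subset_compact_of_bounded (f := T.toLinearMap) hT hA
  -- Inside a compact set it suffices that `T x` is the only cluster point, and functionals on `F`
  -- recognise it.
  refine hK.tendsto_nhds_of_unique_mapClusterPt
    (Eventually.of_forall fun n => hTK (mem_image_of_mem _ (hu n))) fun z _ hz => ?_
  by_contra hne
  obtain ⟨φ, hφ⟩ := SeparatingDual.exists_separating_of_ne (R := ℝ) (V := F) hne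
  have h1 : MapClusterPt (φ z) atTop (φ ∘ fun n => T (u n)) :=
    hz.continuousAt_comp φ.continuous.continuousAt
  have h2 : Tendsto (φ ∘ fun n => T (u n)) atTop (𝓝 (φ (T x))) := hlim (φ.comp T)
  exact hφ (h1.eq_of_tendsto h2)

end WeakTopology

/-! ### Elementary tensors, and operators as the dual of the projective tensor product -/

namespace ProjTensor

variable {X Y : Type*} [NormedAddCommGroup X] [NormedSpace ℝ X]
  [NormedAddCommGroup Y] [NormedSpace ℝ Y]

theorem norm_tmul_le (x : X) (y : Y) : ‖tmul x y‖ ≤ ‖x‖ * ‖y‖ := by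
  rw [tmul, UniformSpace.Completion.norm_coe, AlgProjTensor.norm_def]
  refine (AlgProjTensor.projNorm_le (l := [(x, y)]) ?_).trans_eq ?_
  · simp [AlgProjTensor.listSum]
  · simp [AlgProjTensor.listCost]

variable (X Y) in
/-- The bounded bilinear map `(x, y) ↦ x ⊗ y`. -/
noncomputable def tmulCLM : X →L[ℝ] Y →L[ℝ] ProjTensor X Y :=
  LinearMap.mkContinuous₂
    (LinearMap.mk₂ ℝ tmul
      (fun a b y => (congrArg _ (TensorProduct.add_tmul a b y)).trans
        (UniformSpace.Completion.coe_add _ _))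
      (fun c a y => (congrArg _ (TensorProduct.smul_tmul' c a y).symm).trans
        (UniformSpace.Completion.coe_smul (M := ℝ) (X := AlgProjTensor X Y) c _))
      (fun x a b => (congrArg _ (TensorProduct.tmul_add x a b)).trans
        (UniformSpace.Completion.coe_add _ _))
      (fun c x a => (congrArg _ (TensorProduct.tmul_smul c x a)).trans
        (UniformSpace.Completion.coe_smul (M := ℝ) (X := AlgProjTensor X Y) c _)))
    1 fun x y => by rw [one_mul]; exact norm_tmul_le x y

@[simp]
theorem tmulCLM_apply (x : X) (y : Y) : tmulCLM X Y x y = tmul x y := rfl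

theorem tmul_neg_neg (x : X) (y : Y) : tmul (-x) (-y) = tmul x y := by
  rw [← tmulCLM_apply, ← tmulCLM_apply, map_neg, map_neg, neg_apply, neg_neg]

theorem coe_listSum (l : List (X × Y)) :
    ((AlgProjTensor.listSum l : AlgProjTensor X Y) : ProjTensor X Y) =
      (l.map fun p => tmul p.1 p.2).sum := by
  induction l with
  | nil => exact UniformSpace.Completion.coe_zero
  | cons p l ih =>
    rw [List.map_cons, List.sum_cons, ← ih]
    exact UniformSpace.Completion.coe_add _ _

/-- The operator `X → Y*` of a continuous linear functional on `X ⊗̂_π Y`. -/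
noncomputable def toOperator (S : StrongDual ℝ (ProjTensor X Y)) : X →L[ℝ] StrongDual ℝ Y :=
  (ContinuousLinearMap.compL ℝ Y (ProjTensor X Y) ℝ S).comp (tmulCLM X Y)

@[simp]
theorem toOperator_apply (S : StrongDual ℝ (ProjTensor X Y)) (x : X) (y : Y) :
    toOperator S x y = S (tmul x y) := rfl

/-- Both sides are continuous and agree on elementary tensors, whose sums are dense. Thus every
functional comes from an operator. -/
theorem functional_toOperator (S : StrongDual ℝ (ProjTensor X Y)) :
    functional (toOperator S) = S := by
  refine ContinuousLinearMap.ext fun z => ?_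
  induction z using UniformSpace.Completion.induction_on with
  | hp => exact isClosed_eq (functional _).continuous S.continuous
  | ih w =>
    obtain ⟨l, rfl⟩ := AlgProjTensor.exists_listSum w
    rw [coe_listSum]
    induction l with
    | nil => simp
    | cons p l ih => simp only [List.map_cons, List.sum_cons, map_add, ih, functional_tmul,
        toOperator_apply]

/-- The rank one operator `x ↦ f(x) g`, whose functional is `f ⊗ g`. -/
noncomputable def rankOne (f : StrongDual ℝ X) (g : StrongDual ℝ Y) : X →L[ℝ] StrongDual ℝ Y :=
  f.smulRight g

@[simp]
theorem functional_rankOne_tmul (f : StrongDual ℝ X) (g : StrongDual ℝ Y) (x : X) (y : Y) :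
    functional (rankOne f g) (tmul x y) = f x * g y := by
  rw [functional_tmul]; rfl

/-- Take `φ ⊗ g` with `g y = 1`. This makes `x ↦ x ⊗ y` a weak embedding. -/
theorem exists_extension_tmul_right {y : Y} (hy : y ≠ 0) (φ : StrongDual ℝ X) :
    ∃ ψ : StrongDual ℝ (ProjTensor X Y), ∀ x, ψ (tmul x y) = φ x := by
  obtain ⟨g, -, hg⟩ := exists_dual_vector ℝ y (norm_ne_zero_iff.2 hy)
  refine ⟨functional (rankOne φ (‖y‖⁻¹ • g)), fun x => ?_⟩
  rw [functional_rankOne_tmul, smul_apply, hg, smul_eq_mul]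
  have : ‖y‖ ≠ 0 := norm_ne_zero_iff.2 hy
  simp [this]

theorem exists_extension_tmul_left {x : X} (hx : x ≠ 0) (φ : StrongDual ℝ Y) :
    ∃ ψ : StrongDual ℝ (ProjTensor X Y), ∀ y, ψ (tmul x y) = φ y := by
  obtain ⟨g, -, hg⟩ := exists_dual_vector ℝ x (norm_ne_zero_iff.2 hx)
  refine ⟨functional (rankOne (‖x‖⁻¹ • g) φ), fun y => ?_⟩
  rw [functional_rankOne_tmul, smul_apply, hg, smul_eq_mul]
  have : ‖x‖ ≠ 0 := norm_ne_zero_iff.2 hx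
  simp [this]

theorem tmul_ne_zero {x : X} {y : Y} (hx : x ≠ 0) (hy : y ≠ 0) : tmul x y ≠ 0 := by
  intro h
  obtain ⟨φ, hφ⟩ := SeparatingDual.exists_separating_of_ne (R := ℝ) (V := X) hx
  obtain ⟨ψ, hψ⟩ := exists_extension_tmul_right hy φ
  apply hφ
  rw [← hψ, h, map_zero, map_zero]

/-! ### The compact approximation property implies separation -/

section CompactApproximation

/-- Every element of `X ⊗̂_π Y` is, as a functional on operators, controlled by the values of the
operator on a compact set. -/
theorem exists_compact_bound (z : ProjTensor X Y) :
    ∃ K : Set X, IsCompact K ∧ ∃ M : ℝ, 0 < M ∧ ∀ (R : X →L[ℝ] StrongDual ℝ Y) (ε : ℝ),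
      0 ≤ ε → (∀ k ∈ K, ‖R k‖ ≤ ε) → |functional R z| ≤ M * ε := by
  have hz : z ∈ closure ((UniformSpace.Completion.toCompl (α := AlgProjTensor X Y)).range :
      Set (ProjTensor X Y)) := UniformSpace.Completion.denseRange_coe z
  obtain ⟨v, hv, hvr, -, hvb⟩ := controlled_sum_of_mem_closure hz
    (b := fun n => (1 / 4 : ℝ) ^ n) fun n => by positivity
  -- The constant covers `v 0`, whose norm is not controlled, and leaves the strict slack needed to
  -- nearly attain the infimum in the projective norm.
  have hl : ∀ n, ∃ l : List (X × Y), (l.map fun p => tmul p.1 p.2).sum = v n ∧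
      AlgProjTensor.listCost l ≤ (‖v 0‖ + 2) * (1 / 4 : ℝ) ^ n := by
    intro n
    obtain ⟨w, hw⟩ := hvr n
    have hw' : ((w : AlgProjTensor X Y) : ProjTensor X Y) = v n := hw
    have hlt : ‖w‖ < (‖v 0‖ + 2) * (1 / 4 : ℝ) ^ n := by
      rw [← UniformSpace.Completion.norm_coe, hw']
      rcases n.eq_zero_or_pos with rfl | hn
      · rw [pow_zero]; linarith
      · have h1 := hvb n hn
        have h2 : 0 ≤ ‖v 0‖ * (1 / 4 : ℝ) ^ n := by positivity
        have h3 : 0 < (1 / 4 : ℝ) ^ n := by positivity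
        linarith
    by_contra! hall
    refine hlt.not_ge (AlgProjTensor.le_projNorm fun l hl => (hall l ?_).le)
    rw [← coe_listSum, hl, hw']
  choose l hlv hlc using hl
  -- The decay `4⁻ⁿ` is split: first factors rescaled to norm `2⁻ⁿ` form the compact set, and the
  -- remaining `2⁻ⁿ` keeps the series summable with total `2`.
  let s : ℕ → Set X := fun n =>
    (fun p : X × Y => ((1 / 2 : ℝ) ^ n * ‖p.1‖⁻¹) • p.1) '' {p | p ∈ l n}
  have hcpt : IsCompact (insert 0 (⋃ n, s n)) := by
    refine isCompact_insert_zero_iUnion_of_finite (r := fun n => (1 / 2 : ℝ) ^ n)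
      (fun n => (List.finite_toSet (l n)).image _)
      (tendsto_pow_atTop_nhds_zero_of_lt_one (by norm_num) (by norm_num)) ?_
    rintro n _ ⟨p, -, rfl⟩
    rw [norm_smul, norm_mul, norm_inv, norm_norm, Real.norm_of_nonneg (by positivity), mul_assoc]
    exact mul_le_of_le_one_right (by positivity) inv_mul_le_one
  refine ⟨_, hcpt, (‖v 0‖ + 2) * 2, by positivity, fun R ε hε hR => ?_⟩
  have hpair : ∀ n, ∀ p ∈ l n, |R p.1 p.2| ≤ (2 : ℝ) ^ n * ε * (‖p.1‖ * ‖p.2‖) := by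
    intro n p hp
    have h1 : ‖R (((1 / 2 : ℝ) ^ n * ‖p.1‖⁻¹) • p.1)‖ ≤ ε :=
      hR _ (mem_insert_of_mem _ (mem_iUnion.2 ⟨n, p, hp, rfl⟩))
    have h2 : ‖R p.1‖ ≤ (2 : ℝ) ^ n * ε * ‖p.1‖ := by
      rcases eq_or_ne p.1 0 with h0 | h0
      · rw [h0, map_zero, norm_zero, norm_zero, mul_zero]
      · have hpos : 0 < ‖p.1‖ := norm_pos_iff.2 h0
        rw [map_smul, norm_smul, norm_mul, norm_inv, norm_norm,
          Real.norm_of_nonneg (by positivity), one_div, inv_pow, ← mul_inv,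
          inv_mul_le_iff₀ (by positivity)] at h1
        linarith
    calc |R p.1 p.2| ≤ ‖R p.1‖ * ‖p.2‖ := (R p.1).le_opNorm p.2
      _ ≤ (2 : ℝ) ^ n * ε * ‖p.1‖ * ‖p.2‖ := by gcongr
      _ = _ := by ring
  have hlist : ∀ (n : ℕ) (m : List (X × Y)),
      (∀ p ∈ m, |R p.1 p.2| ≤ (2 : ℝ) ^ n * ε * (‖p.1‖ * ‖p.2‖)) →
      |functional R (m.map fun p => tmul p.1 p.2).sum| ≤
        (2 : ℝ) ^ n * ε * AlgProjTensor.listCost m := by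
    intro n m
    induction m with
    | nil => simp [AlgProjTensor.listCost]
    | cons p m ih =>
      intro h
      have h1 := h p (by simp)
      have h2 := ih fun q hq => h q (by simp [hq])
      simp only [AlgProjTensor.listCost] at h2
      simp only [List.map_cons, List.sum_cons, map_add, functional_tmul, AlgProjTensor.listCost]
      refine (abs_add_le _ _).trans ?_
      rw [mul_add]
      exact add_le_add h1 h2
  have hterm : ∀ n, |functional R (v n)| ≤ (‖v 0‖ + 2) * ε * (1 / 2 : ℝ) ^ n := by
    intro n
    rw [← hlv n]
    refine (hlist n (l n) (hpair n)).trans ?_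
    calc (2 : ℝ) ^ n * ε * AlgProjTensor.listCost (l n)
        ≤ (2 : ℝ) ^ n * ε * ((‖v 0‖ + 2) * (1 / 4 : ℝ) ^ n) := by gcongr; exact hlc n
      _ = (‖v 0‖ + 2) * ε * ((2 : ℝ) ^ n * (1 / 4 : ℝ) ^ n) := by ring
      _ = _ := by rw [← mul_pow]; norm_num
  have hlim := (((functional R).continuous.tendsto z).comp hv).abs
  refine le_of_tendsto hlim (Eventually.of_forall fun n => ?_)
  simp only [Function.comp_apply, map_sum]
  calc |∑ i ∈ Finset.range (n + 1), functional R (v i)|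
      ≤ ∑ i ∈ Finset.range (n + 1), |functional R (v i)| := Finset.abs_sum_le_sum_abs _ _
    _ ≤ ∑ i ∈ Finset.range (n + 1), (‖v 0‖ + 2) * ε * (1 / 2 : ℝ) ^ i :=
        Finset.sum_le_sum fun i _ => hterm i
    _ = (‖v 0‖ + 2) * ε * ∑ i ∈ Finset.range (n + 1), (1 / 2 : ℝ) ^ i := by
        rw [Finset.mul_sum]
    _ ≤ (‖v 0‖ + 2) * ε * 2 := by gcongr; exact sum_geometric_two_le _
    _ = _ := by ring

theorem functional_sub (T S : X →L[ℝ] StrongDual ℝ Y) (z : ProjTensor X Y) :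
    functional (T - S) z = functional T z - functional S z := by
  have h : functional (T - S) = functional T - functional S := by
    rw [← functional_toOperator (functional T - functional S)]
    congr 1
    ext x y
    simp [functional_tmul]
  rw [h, sub_apply]

/-- A functional separating `z` from `w` is an operator `S`. Compact operators vanish at `z - w` and
approximate `S` on the compact set that controls values at `z - w`, so `S` vanishes there too. -/
theorem compactOperatorsSeparate_of_hasPairCAP (h : HasPairCAP X (StrongDual ℝ Y)) :
    CompactOperatorsSeparate X Y := by
  intro z w hzw
  by_contra hne
  obtain ⟨S, hS⟩ := SeparatingDual.exists_separating_of_ne (R := ℝ) hne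
  apply hS
  rw [← sub_eq_zero, ← map_sub]
  obtain ⟨K, hK, M, hM, hbound⟩ := exists_compact_bound (z - w)
  refine abs_eq_zero.1 (le_antisymm (le_of_forall_pos_le_add fun ε hε => ?_) (abs_nonneg _))
  have hball : Metric.closedBall (0 : StrongDual ℝ Y) (ε / M) ∈ 𝓝 0 :=
    Metric.closedBall_mem_nhds _ (by positivity)
  let S' : CompactConvergenceCLM (RingHom.id ℝ) X (StrongDual ℝ Y) := toOperator S
  have hmem : S' ∈ closure {T : CompactConvergenceCLM (RingHom.id ℝ) X (StrongDual ℝ Y) |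
      IsCompactOperator T} := by
    have := mem_univ S'
    rwa [← h] at this
  have hnhds : {T : CompactConvergenceCLM (RingHom.id ℝ) X (StrongDual ℝ Y) |
      ∀ k ∈ K, (S' - T) k ∈ Metric.closedBall (0 : StrongDual ℝ Y) (ε / M)} ∈ 𝓝 S' := by
    have hc : Tendsto (fun T => S' - T) (𝓝 S') (𝓝 0) := by
      have : Tendsto (fun T => S' - T) (𝓝 S') (𝓝 (S' - S')) :=
        tendsto_const_nhds.sub tendsto_id
      rwa [sub_self] at this
    exact hc (CompactConvergenceCLM.hasBasis_nhds_zero.mem_of_mem (i := (K, _)) ⟨hK, hball⟩)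
  obtain ⟨T, hTK, hT⟩ := mem_closure_iff_nhds.1 hmem _ hnhds
  let T' : X →L[ℝ] StrongDual ℝ Y := T
  have h1 := hbound (toOperator S - T') (ε / M) (by positivity) fun k hk =>
    mem_closedBall_zero_iff.1 (hTK k hk)
  rw [functional_sub, functional_toOperator, map_sub (functional T'), hzw T' hT, sub_self,
    sub_zero, mul_div_cancel₀ _ hM.ne'] at h1
  rwa [zero_add]

end CompactApproximation

end ProjTensor

/-! ### From maximising elementary tensors to the closed convex hull -/

namespace ProjTensor

variable {X Y : Type*} [NormedAddCommGroup X] [NormedSpace ℝ X]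
  [NormedAddCommGroup Y] [NormedSpace ℝ Y]

/-- The functional `S` converges to its value at `x ⊗ y` along elementary tensors of points of
`C` and `D` at which `f` and `g` converge to `f x` and `g y`. -/
def ConvergesAlong (C : Set X) (D : Set Y) (f : StrongDual ℝ X) (g : StrongDual ℝ Y) (x : X)
    (y : Y) (S : StrongDual ℝ (ProjTensor X Y)) : Prop :=
  ∀ (u : ℕ → X) (v : ℕ → Y), (∀ n, u n ∈ C) → (∀ n, v n ∈ D) →
    Tendsto (fun n => f (u n)) atTop (𝓝 (f x)) → Tendsto (fun n => g (v n)) atTop (𝓝 (g y)) →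
      Tendsto (fun n => S (tmul (u n) (v n))) atTop (𝓝 (S (tmul x y)))

variable {C : Set X} {D : Set Y} {f : StrongDual ℝ X} {g : StrongDual ℝ Y} {x : X} {y : Y}
  {S : StrongDual ℝ (ProjTensor X Y)}

/-- Uniform form of the sequential condition: counterexamples for `δ = 1 / (n + 1)` would form
maximising sequences, because `f x` and `g y` are upper bounds. -/
theorem ConvergesAlong.exists_delta (hS : ConvergesAlong C D f g x y S)
    (hf : ∀ a ∈ C, f a ≤ f x) (hg : ∀ b ∈ D, g b ≤ g y) {ε : ℝ} (hε : 0 < ε) :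
    ∃ δ > 0, ∀ a ∈ C, ∀ b ∈ D, f x - δ < f a → g y - δ < g b →
      |S (tmul a b) - S (tmul x y)| < ε := by
  by_contra! hcon
  choose u hu v hv hfu hgv hfar using fun n : ℕ => hcon (1 / ((n : ℝ) + 1)) (by positivity)
  have h0 : Tendsto (fun n : ℕ => 1 / ((n : ℝ) + 1)) atTop (𝓝 0) :=
    tendsto_one_div_add_atTop_nhds_zero_nat
  have hsq : ∀ c : ℝ, Tendsto (fun n : ℕ => c - 1 / ((n : ℝ) + 1)) atTop (𝓝 c) := fun c => by
    simpa using h0.const_sub c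
  have hlim := hS u v hu hv
    (tendsto_of_tendsto_of_tendsto_of_le_of_le (hsq _) tendsto_const_nhds (fun n => (hfu n).le)
      fun n => hf _ (hu n))
    (tendsto_of_tendsto_of_tendsto_of_le_of_le (hsq _) tendsto_const_nhds (fun n => (hgv n).le)
      fun n => hg _ (hv n))
  obtain ⟨n, hn⟩ := (Metric.tendsto_nhds.1 hlim ε hε).exists
  exact (hfar n).not_gt hn

/-- An elementary tensor with small deficit has, up to a common sign, both factors nearly maximal,
so `S` is within `ε`. With large deficit, a large `K` absorbs the crude bound on `S`. Convexity and
continuity carry the inequality to the hull. -/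
theorem ConvergesAlong.exists_bound (hS : ConvergesAlong C D f g x y S)
    (hC : ∀ a ∈ C, -a ∈ C) (hCb : Bornology.IsBounded C)
    (hD : ∀ b ∈ D, -b ∈ D) (hDb : Bornology.IsBounded D) (hx : x ∈ C) (hy : y ∈ D)
    (hf : ∀ a ∈ C, f a ≤ f x) (hg : ∀ b ∈ D, g b ≤ g y) (hfx : 0 < f x) (hgy : 0 < g y)
    {ε : ℝ} (hε : 0 < ε) :
    ∃ K : ℝ, ∀ z ∈ closedConvexHull ℝ (setTensor C D),
      |S z - S (tmul x y)| ≤ ε + K * (f x * g y - functional (rankOne f g) z) := by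
  obtain ⟨δ, hδ, hclose⟩ := hS.exists_delta hf hg hε
  obtain ⟨c, hc⟩ := hCb.exists_norm_le
  obtain ⟨d, hd⟩ := hDb.exists_norm_le
  have hc0 : 0 ≤ c := (norm_nonneg x).trans (hc x hx)
  have hd0 : 0 ≤ d := (norm_nonneg y).trans (hd y hy)
  have hM : ∀ a ∈ C, ∀ b ∈ D, |S (tmul a b)| ≤ ‖S‖ * (c * d) := fun a ha b hb =>
    calc |S (tmul a b)| ≤ ‖S‖ * ‖tmul a b‖ := S.le_opNorm _
      _ ≤ ‖S‖ * (‖a‖ * ‖b‖) := by gcongr; exact norm_tmul_le a b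
      _ ≤ ‖S‖ * (c * d) := by gcongr; exacts [hc a ha, hd b hb]
  set p := f x
  set q := g y
  -- A deficit below `p * q` makes `f a * g b` positive; below `δ * q` it forces `f a > p - δ`, and
  -- below `δ * p` it forces `g b > q - δ`.
  set η := min (p * q) (min (δ * p) (δ * q)) with hη
  have hηpos : 0 < η := by positivity
  have hpos : ∀ a ∈ C, ∀ b ∈ D, 0 ≤ f a → p * q - f a * g b < η →
      |S (tmul a b) - S (tmul x y)| < ε := by
    intro a ha b hb hfa hlt
    have h1 : η ≤ p * q := min_le_left _ _
    have h2 : η ≤ δ * p := (min_le_right _ _).trans (min_le_left _ _)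
    have h3 : η ≤ δ * q := (min_le_right _ _).trans (min_le_right _ _)
    have hprod : 0 < f a * g b := by linarith
    have hgb : 0 < g b := (pos_iff_pos_of_mul_pos hprod).1
      (lt_of_le_of_ne hfa fun h => by rw [← h, zero_mul] at hprod; exact hprod.false)
    refine hclose a ha b hb ?_ ?_
    · have : f a * g b ≤ f a * q := mul_le_mul_of_nonneg_left (hg b hb) hfa
      refine lt_of_mul_lt_mul_right (a := q) ?_ hgy.le
      rw [sub_mul]; linarith
    · have : f a * g b ≤ p * g b := mul_le_mul_of_nonneg_right (hf a ha) hgb.le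
      refine lt_of_mul_lt_mul_left (a := p) ?_ hfx.le
      rw [mul_sub]; linarith
  have habs : ∀ a ∈ C, ∀ b ∈ D, f a * g b ≤ p * q := by
    intro a ha b hb
    have h1 := hf _ (hC a ha)
    have h2 := hg _ (hD b hb)
    rw [map_neg] at h1 h2
    refine (le_abs_self _).trans ?_
    rw [abs_mul]
    exact mul_le_mul (abs_le.2 ⟨by linarith, hf a ha⟩) (abs_le.2 ⟨by linarith, hg b hb⟩)
      (abs_nonneg _) hfx.le
  -- Chosen so that `K * η` is the trivial bound for `|S (a ⊗ b) - S (x ⊗ y)|`.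
  refine ⟨2 * (‖S‖ * (c * d)) / η, fun z hz => ?_⟩
  set K := 2 * (‖S‖ * (c * d)) / η with hK
  have hK0 : 0 ≤ K := by positivity
  -- `G` is convex and continuous, so its sublevel sets are closed and convex: one that contains `C
  -- ⊗ D` contains the hull.
  let G : ProjTensor X Y → ℝ := fun z =>
    |S z - S (tmul x y)| + K * functional (rankOne f g) z
  have hGconv : ConvexOn ℝ univ G := by
    refine ⟨convex_univ, fun z _ w _ s t hs ht hst => ?_⟩
    have h1 : S (s • z + t • w) - S (tmul x y) =
        s * (S z - S (tmul x y)) + t * (S w - S (tmul x y)) := by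
      rw [map_add, map_smul, map_smul, smul_eq_mul, smul_eq_mul]
      linear_combination (S (tmul x y)) * hst
    have h2 := abs_add_le (s * (S z - S (tmul x y))) (t * (S w - S (tmul x y)))
    rw [abs_mul, abs_mul, abs_of_nonneg hs, abs_of_nonneg ht, ← h1] at h2
    simp only [G, map_add (functional (rankOne f g)), map_smul (functional (rankOne f g)),
      smul_eq_mul]
    linarith
  have hGcont : Continuous G := by fun_prop
  have hle : closedConvexHull ℝ (setTensor C D) ⊆ {z | G z ≤ ε + K * (p * q)} := by
    refine closedConvexHull_min ?_ (by simpa using hGconv.convex_le (ε + K * (p * q)))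
      (isClosed_le hGcont continuous_const)
    rintro _ ⟨a, ha, b, hb, rfl⟩
    simp only [G, mem_ofPred_eq, functional_rankOne_tmul]
    suffices h : |S (tmul a b) - S (tmul x y)| ≤ ε + K * (p * q - f a * g b) by linarith
    have hnn : 0 ≤ K * (p * q - f a * g b) := mul_nonneg hK0 (sub_nonneg.2 (habs a ha b hb))
    by_cases hlt : p * q - f a * g b < η
    · have hsmall : |S (tmul a b) - S (tmul x y)| < ε := by
        -- The pairs `(a, b)` and `(-a, -b)` give the same tensor, so `0 ≤ f a` may be assumed.
        rcases le_total 0 (f a) with h | h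
        · exact hpos a ha b hb h hlt
        · have := hpos (-a) (hC a ha) (-b) (hD b hb) (by rw [map_neg]; linarith)
            (by rwa [map_neg, map_neg, neg_mul_neg])
          rwa [tmul_neg_neg] at this
      linarith
    · have h1 : 2 * (‖S‖ * (c * d)) ≤ K * (p * q - f a * g b) :=
        calc 2 * (‖S‖ * (c * d)) = K * η := by rw [hK, div_mul_cancel₀ _ hηpos.ne']
          _ ≤ _ := mul_le_mul_of_nonneg_left (not_lt.1 hlt) hK0
      have h2 := abs_sub (S (tmul a b)) (S (tmul x y))
      have h3 := hM a ha b hb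
      have h4 := hM x hx y hy
      linarith
  have := hle hz
  simp only [G, mem_ofPred_eq] at this
  linarith

/-- If `x ∈ C` and `y ∈ D` are exposed by `f` and `g`, if the functionals in `𝒮` converge along
the sequences in `C ⊗ D` that are maximising for `f` and `g`, and if `𝒮` determines the point
`x ⊗ y` and the weak convergence to it, then `x ⊗ y` is `w`-strongly exposed by `f ⊗ g`. -/
theorem isWStronglyExposed_tmul (hC : ∀ a ∈ C, -a ∈ C) (hCb : Bornology.IsBounded C)
    (hC0 : C ≠ {0}) (hD : ∀ b ∈ D, -b ∈ D) (hDb : Bornology.IsBounded D) (hD0 : D ≠ {0})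
    (hx : x ∈ C) (hy : y ∈ D) (hf : Exposes C f x) (hg : Exposes D g y)
    (𝒮 : Set (StrongDual ℝ (ProjTensor X Y))) (h𝒮 : ∀ S ∈ 𝒮, ConvergesAlong C D f g x y S)
    (hsep : ∀ z, (∀ S ∈ 𝒮, S z = S (tmul x y)) → z = tmul x y)
    (hconv : ∀ z : ℕ → ProjTensor X Y, (∀ n, z n ∈ closedConvexHull ℝ (setTensor C D)) →
      (∀ S ∈ 𝒮, Tendsto (fun n => S (z n)) atTop (𝓝 (S (tmul x y)))) →
      Tendsto (fun n => toWeakSpace ℝ (ProjTensor X Y) (z n)) atTop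
        (𝓝 (toWeakSpace ℝ (ProjTensor X Y) (tmul x y)))) :
    IsWStronglyExposed (closedConvexHull ℝ (setTensor C D)) (tmul x y) := by
  have hfx := hf.pos_of_symmetric hx hC hC0
  have hgy := hg.pos_of_symmetric hy hD hD0
  have key : ∀ z : ℕ → ProjTensor X Y, (∀ n, z n ∈ closedConvexHull ℝ (setTensor C D)) →
      Tendsto (fun n => functional (rankOne f g) (z n)) atTop (𝓝 (f x * g y)) →
      ∀ S ∈ 𝒮, Tendsto (fun n => S (z n)) atTop (𝓝 (S (tmul x y))) := by
    intro z hz hlim S hS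
    refine Metric.tendsto_nhds.2 fun ε hε => ?_
    obtain ⟨K, hK⟩ := (h𝒮 S hS).exists_bound hC hCb hD hDb hx hy (fun a => hf.le)
      (fun b => hg.le) hfx hgy (half_pos hε)
    have h1 : Tendsto (fun n => ε / 2 + K * (f x * g y - functional (rankOne f g) (z n))) atTop
        (𝓝 (ε / 2)) := by
      simpa using ((hlim.const_sub (f x * g y)).const_mul K).const_add (ε / 2)
    filter_upwards [h1.eventually (gt_mem_nhds (half_lt_self hε))] with n hn
    exact (hK _ (hz n)).trans_lt hn
  have hmax : ∀ z ∈ closedConvexHull ℝ (setTensor C D),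
      functional (rankOne f g) z ≤ f x * g y := by
    intro z hz
    have hsub : closedConvexHull ℝ (setTensor C D) ⊆
        {z | functional (rankOne f g) z ≤ f x * g y} := by
      refine closedConvexHull_min ?_
        (convex_halfSpace_le (functional (rankOne f g)).toLinearMap.isLinear _)
        (isClosed_le (functional _).continuous continuous_const)
      rintro _ ⟨a, ha, b, hb, rfl⟩
      rw [mem_ofPred_eq, functional_rankOne_tmul]
      have h1 := hf.le (hC a ha)
      have h2 := hg.le (hD b hb)
      rw [map_neg] at h1 h2
      refine (le_abs_self _).trans ?_
      rw [abs_mul]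
      exact mul_le_mul (abs_le.2 ⟨by linarith, hf.le ha⟩) (abs_le.2 ⟨by linarith, hg.le hb⟩)
        (abs_nonneg _) hfx.le
    exact hsub hz
  refine ⟨subset_closedConvexHull ⟨x, hx, y, hy, rfl⟩, functional (rankOne f g), ?_, ?_⟩
  · rintro z ⟨hz, hne⟩
    rw [functional_rankOne_tmul]
    refine lt_of_le_of_ne (hmax z hz) fun heq => hne (hsep z fun S hS => ?_)
    -- A maximiser `z` of `f ⊗ g` gives a constant maximising sequence, so `𝒮` cannot tell `z` from
    -- `x ⊗ y`.
    exact tendsto_nhds_unique tendsto_const_nhds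
      (key (fun _ => z) (fun _ => hz) (by rw [heq]; exact tendsto_const_nhds) S hS)
  · intro z hz hlim
    rw [functional_rankOne_tmul] at hlim
    exact hconv z hz (key z hz hlim)

/-- The functional of a compact operator converges along pairs of weakly convergent bounded
sequences. -/
theorem convergesAlong_of_isCompactOperator (hCb : Bornology.IsBounded C)
    (hDb : Bornology.IsBounded D)
    (hf : ∀ u : ℕ → X, (∀ n, u n ∈ C) → Tendsto (fun n => f (u n)) atTop (𝓝 (f x)) →
      Tendsto (fun n => toWeakSpace ℝ X (u n)) atTop (𝓝 (toWeakSpace ℝ X x)))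
    (hg : ∀ v : ℕ → Y, (∀ n, v n ∈ D) → Tendsto (fun n => g (v n)) atTop (𝓝 (g y)) →
      Tendsto (fun n => toWeakSpace ℝ Y (v n)) atTop (𝓝 (toWeakSpace ℝ Y y)))
    {T : X →L[ℝ] StrongDual ℝ Y} (hT : IsCompactOperator T) :
    ConvergesAlong C D f g x y (functional T) := by
  intro u v hu hv hfu hgv
  simp only [functional_tmul]
  -- Split `T (u n) (v n) = (T (u n) - T x) (v n) + T x (v n)`: the first term tends to `0` by norm
  -- convergence and boundedness of `D`, the second needs only weak convergence.
  have h1 : Tendsto (fun n => T (u n)) atTop (𝓝 (T x)) :=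
    hT.tendsto_of_weak hCb hu (tendsto_toWeakSpace_iff.1 (hf u hu hfu))
  have h2 : Tendsto (fun n => T x (v n)) atTop (𝓝 (T x y)) :=
    tendsto_toWeakSpace_iff.1 (hg v hv hgv) (T x)
  obtain ⟨d, hd⟩ := hDb.exists_norm_le
  have h3 : Tendsto (fun n => (T (u n) - T x) (v n)) atTop (𝓝 0) := by
    refine squeeze_zero_norm (a := fun n => ‖T (u n) - T x‖ * d) (fun n => ?_) ?_
    · exact ((T (u n) - T x).le_opNorm _).trans (by gcongr; exact hd _ (hv n))
    · simpa using (tendsto_iff_norm_sub_tendsto_zero.1 h1).mul_const d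
  simpa using h3.add h2

/-- If `C ⊗ D` is weakly compact and the compact operators separate points, every functional
converges along a sequence in `C ⊗ D` as soon as the functionals of compact operators do. -/
theorem convergesAlong_of_isCompact (hsep : CompactOperatorsSeparate X Y)
    (hcpt : IsCompact (toWeakSpace ℝ (ProjTensor X Y) '' setTensor C D))
    (hT : ∀ T : X →L[ℝ] StrongDual ℝ Y, IsCompactOperator T →
      ConvergesAlong C D f g x y (functional T)) (S : StrongDual ℝ (ProjTensor X Y)) :
    ConvergesAlong C D f g x y S := by
  intro u v hu hv hfu hgv
  suffices h : Tendsto (fun n => toWeakSpace ℝ (ProjTensor X Y) (tmul (u n) (v n))) atTop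
      (𝓝 (toWeakSpace ℝ (ProjTensor X Y) (tmul x y))) from tendsto_toWeakSpace_iff.1 h S
  -- By weak compactness only cluster points matter, and compact operators take the same values at
  -- each of them as at `x ⊗ y`.
  refine hcpt.tendsto_nhds_of_unique_mapClusterPt
    (Eventually.of_forall fun n => mem_image_of_mem _ ⟨u n, hu n, v n, hv n, rfl⟩)
    fun w _ hw => ?_
  rw [← LinearEquiv.symm_apply_eq]
  refine hsep _ _ fun T hTc => ?_
  have h1 := hw.continuousAt_comp (continuous_weakSpace_eval (functional T)).continuousAt
  exact MapClusterPt.eq_of_tendsto h1 (hT T hTc u v hu hv hfu hgv)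

/-- Slices are strict inequalities on finitely many compact operators, so a sequence on which these
operators converge eventually lies in them. -/
theorem tendsto_weak_of_hasCompactNhdSystem (hN : HasCompactNhdSystem C D x y)
    {z : ℕ → ProjTensor X Y} (hz : ∀ n, z n ∈ closedConvexHull ℝ (setTensor C D))
    (hlim : ∀ T : X →L[ℝ] StrongDual ℝ Y, IsCompactOperator T →
      Tendsto (fun n => functional T (z n)) atTop (𝓝 (functional T (tmul x y)))) :
    Tendsto (fun n => toWeakSpace ℝ (ProjTensor X Y) (z n)) atTop
      (𝓝 (toWeakSpace ℝ (ProjTensor X Y) (tmul x y))) := by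
  refine tendsto_nhds.2 fun U hU hmem => ?_
  obtain ⟨n, T, α, hT, -, hxy, hsub⟩ := hN U hU hmem
  have hev : ∀ᶠ k in atTop, ∀ i, sSup (functional (T i) ''
      closedConvexHull ℝ (setTensor C D)) - α i < functional (T i) (z k) :=
    eventually_all.2 fun i => (hlim (T i) (hT i)).eventually
      (lt_mem_nhds (mem_iInter.1 hxy i).2)
  filter_upwards [hev] with k hk
  exact hsub (mem_iInter.2 fun i => ⟨hz k, hk i⟩)

theorem isWStronglyExposed_of_tmul (hC : ∀ a ∈ C, -a ∈ C) (hC0 : C ≠ {0})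
    (hD0 : D ≠ {0}) (hx : x ∈ C) (hy : y ∈ D)
    (h : IsWStronglyExposed (closedConvexHull ℝ (setTensor C D)) (tmul x y)) :
    IsWStronglyExposed C x ∧ IsWStronglyExposed D y := by
  -- If `0` were exposed by `S`, both `a ⊗ b` and its negative would have negative value under `S`.
  have hne : tmul x y ≠ 0 := by
    obtain ⟨a, ha, ha0⟩ : ∃ a ∈ C, a ≠ 0 := by
      by_contra! hall
      exact hC0 (Subset.antisymm hall (singleton_subset_iff.2 (hall x hx ▸ hx)))
    obtain ⟨b, hb, hb0⟩ : ∃ b ∈ D, b ≠ 0 := by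
      by_contra! hall
      exact hD0 (Subset.antisymm hall (singleton_subset_iff.2 (hall y hy ▸ hy)))
    obtain ⟨-, S, hS, -⟩ := h
    intro h0
    rw [h0] at hS
    have h1 := hS (tmul a b) ⟨subset_closedConvexHull ⟨a, ha, b, hb, rfl⟩, tmul_ne_zero ha0 hb0⟩
    have h2 := hS (tmul (-a) b) ⟨subset_closedConvexHull ⟨-a, hC a ha, b, hb, rfl⟩,
      tmul_ne_zero (neg_ne_zero.2 ha0) hb0⟩
    have h3 : tmul (-a) b = -tmul a b := by
      rw [← tmulCLM_apply, map_neg]; rfl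
    rw [h3, map_neg, map_zero] at h2
    rw [map_zero] at h1
    linarith
  have hx0 : x ≠ 0 := by
    rintro rfl
    exact hne (by rw [← tmulCLM_apply, map_zero]; rfl)
  have hy0 : y ≠ 0 := by
    rintro rfl
    exact hne (by rw [← tmulCLM_apply, map_zero])
  have hmem : ∀ a ∈ C, ∀ b ∈ D, tmul a b ∈ closedConvexHull ℝ (setTensor C D) :=
    fun a ha b hb => subset_closedConvexHull ⟨a, ha, b, hb, rfl⟩
  exact ⟨h.of_map ((tmulCLM X Y).flip y) (exists_extension_tmul_right hy0)
      (fun a ha => hmem a ha y hy) hx,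
    h.of_map (tmulCLM X Y x) (exists_extension_tmul_left hx0) (fun b hb => hmem x hx b hb) hy⟩

end ProjTensor

/-! ### Weakly compact sets of elementary tensors, and the theorem -/

/-- A `w`-strongly exposed point of the closed convex hull of a weakly compact set
belongs to the set. -/
theorem IsWStronglyExposed.mem_of_isCompact {E : Type*} [NormedAddCommGroup E] [NormedSpace ℝ E]
    {A : Set E} (hA : IsCompact (toWeakSpace ℝ E '' A)) {x : E}
    (h : IsWStronglyExposed (closedConvexHull ℝ A) x) : x ∈ A := by
  obtain ⟨hx, S, hS, hconv⟩ := h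
  -- Otherwise a closed half-space contains `A`, hence its hull, but not `x`.
  have hclose : ∀ n : ℕ, ∃ a ∈ A, S x - 1 / ((n : ℝ) + 1) < S a := by
    intro n
    by_contra! hall
    have hsub : closedConvexHull ℝ A ⊆ {z | S z ≤ S x - 1 / ((n : ℝ) + 1)} :=
      closedConvexHull_min hall (convex_halfSpace_le S.toLinearMap.isLinear _)
        (isClosed_le S.continuous continuous_const)
    have h1 := hsub hx
    have h2 : (0 : ℝ) < 1 / ((n : ℝ) + 1) := by positivity
    simp only [mem_ofPred_eq] at h1
    linarith
  choose u hu hSu using hclose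
  have hlim : Tendsto (fun n => S (u n)) atTop (𝓝 (S x)) := by
    refine tendsto_of_tendsto_of_tendsto_of_le_of_le ?_ tendsto_const_nhds (fun n => (hSu n).le)
      fun n => hS.le (subset_closedConvexHull (hu n))
    simpa using (tendsto_one_div_add_atTop_nhds_zero_nat (𝕜 := ℝ)).const_sub (S x)
  obtain ⟨a, ha, hax⟩ := hA.isClosed.mem_of_tendsto
    (hconv u (fun n => subset_closedConvexHull (hu n)) hlim)
    (Eventually.of_forall fun n => mem_image_of_mem _ (hu n))
  exact (toWeakSpace ℝ E).injective hax ▸ ha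

theorem theorem1p3 {X Y : Type*}
    [NormedAddCommGroup X] [NormedSpace ℝ X] [CompleteSpace X]
    [NormedAddCommGroup Y] [NormedSpace ℝ Y] [CompleteSpace Y] :
    (HasPairCAP X (StrongDual ℝ Y) → ProjTensor.CompactOperatorsSeparate X Y) ∧
    (ProjTensor.CompactOperatorsSeparate X Y →
      ∀ (C : Set X) (D : Set Y),
        (∀ x ∈ C, -x ∈ C) → Bornology.IsBounded C → IsClosed C → Convex ℝ C → C ≠ {0} →
        (∀ y ∈ D, -y ∈ D) → Bornology.IsBounded D → IsClosed D → Convex ℝ D → D ≠ {0} →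
        (∀ x ∈ C, ∀ y ∈ D, ProjTensor.HasCompactNhdSystem C D x y →
          (IsWStronglyExposed (closedConvexHull ℝ (ProjTensor.setTensor C D))
              (ProjTensor.tmul x y) ↔
            IsWStronglyExposed C x ∧ IsWStronglyExposed D y)) ∧
        (IsCompact (toWeakSpace ℝ (ProjTensor X Y) '' ProjTensor.setTensor C D) →
          wstrexp (closedConvexHull ℝ (ProjTensor.setTensor C D)) =
            ProjTensor.setTensor (wstrexp C) (wstrexp D))) := by
  refine ⟨ProjTensor.compactOperatorsSeparate_of_hasPairCAP, ?_⟩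
  intro hsep C D hC hCb _ _ hC0 hD hDb _ _ hD0
  refine ⟨fun x hx y hy hN => ⟨ProjTensor.isWStronglyExposed_of_tmul hC hC0 hD0 hx hy, ?_⟩,
    fun hcpt => Subset.antisymm ?_ ?_⟩
  · rintro ⟨⟨-, f, hf, hf'⟩, -, g, hg, hg'⟩
    refine ProjTensor.isWStronglyExposed_tmul hC hCb hC0 hD hDb hD0 hx hy hf hg
      (ProjTensor.functional '' {T | IsCompactOperator T})
      (forall_mem_image.2 fun T hT =>
        ProjTensor.convergesAlong_of_isCompactOperator hCb hDb hf' hg' hT)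
      (fun z hz => hsep _ _ fun T hT => hz _ (mem_image_of_mem _ hT))
      (fun z hz hlim => ProjTensor.tendsto_weak_of_hasCompactNhdSystem hN hz fun T hT =>
        hlim _ (mem_image_of_mem _ hT))
  · intro w hw
    obtain ⟨x, hx, y, hy, rfl⟩ := IsWStronglyExposed.mem_of_isCompact hcpt hw
    obtain ⟨h1, h2⟩ := ProjTensor.isWStronglyExposed_of_tmul hC hC0 hD0 hx hy hw
    exact ⟨x, h1, y, h2, rfl⟩
  · rintro _ ⟨x, ⟨hx, f, hf, hf'⟩, y, ⟨hy, g, hg, hg'⟩, rfl⟩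
    -- Taking all functionals as `𝒮` makes its convergence weak convergence, so no neighbourhood
    -- system is needed.
    refine ProjTensor.isWStronglyExposed_tmul hC hCb hC0 hD hDb hD0 hx hy hf hg univ
      (fun S _ => ProjTensor.convergesAlong_of_isCompact hsep hcpt
        (fun T hT => ProjTensor.convergesAlong_of_isCompactOperator hCb hDb hf' hg' hT) S)
      (fun z hz => hsep _ _ fun T _ => hz _ (mem_univ _))
      (fun z _ hlim => tendsto_toWeakSpace_iff.2 fun S => hlim S (mem_univ S))
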